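/- Let $\mathcal X\subset\mathbb R^{d}$ be bounded, let $\mathcal Z$ be a measurable space, and let $\mathbf x$ and $\mathbf z$ be random variables with values in $\mathcal X$ and $\mathcal Z$, defined on a common probability space, with laws $P(dx)$ and $P(dz)$. Let $E: L_2(P(dx))\to L_2(P(dz))$, $f\mapsto \mathbb E(f(\mathbf x)\mid \mathbf z=\cdot)$, be the conditional expectation operator, with adjoint $E^\top$. A kernel is a real, symmetric, positive semidefinite function of two variables, and the integral operator on $L_2(\mu)$ of a kernel $k$ is $f\mapsto\int k(t,\cdot)f(t)\,\mu(dt)$. For a kernel $k$, $f\sim\mathcal{GP}(0,k)$ means that $f$ is a jointly measurable Gaussian process with mean zero and covariance function $k$; $[f]_\sim$ denotes the $L_2$ equivalence class of a square integrable function $f$. Let $k_x$ be a bounded and continuous kernel on $\mathcal X$ (equivalently, the bounded and continuous reproducing kernel of an RKHS on $\mathcal X$). Then its integral operator $T_x$ on $L_2(P(dx))$ is a well-defined bounded operator, and there is a measurable kernel $k_z$ on $\mathcal Z$ with $\int k_z(z,z)\,P(dz)<\infty$ such that (a) the integral operator of $k_z$ on $L_2(P(dz))$ is $T_z = E\,T_x\,E^\top$;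 (b) a process $g\sim\mathcal{GP}(0,k_z)$ exists, and for all $f\sim\mathcal{GP}(0,k_x)$ and $g\sim\mathcal{GP}(0,k_z)$ (on arbitrary probability spaces), the sample paths of $f$ and $g$ are almost surely square integrable with respect to $P(dx)$ and $P(dz)$, respectively, and the random elements $E[f]_\sim$ and $[g]_\sim$ of $L_2(P(dz))$ have the same distribution. In particular, this holds in the nonparametric instrumental variable (NPIV) model with a second-stage RKHS with kernel $k_x$; no condition on the response, on the structural function or on the eigenvalues of $T_x$ is needed. -/

import Mathlib

open MeasureTheory ProbabilityTheory

noncomputable section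

/-- A (real, symmetric, positive semidefinite) kernel on a set `T`; the index set of the
"matrix" `k` may be infinite, and the quadratic forms range over finitely supported vectors. -/
def IsKernel {T : Type*} (k : T → T → ℝ) : Prop :=
  (Matrix.of k).PosSemidef

/-- `A` is the integral operator `f ↦ ∫ k(t, ·) f(t) μ(dt)` of `k` on `L₂(μ)`. The integrals
are required to converge, and the equation holds `μ`-almost everywhere. -/
def IsIntegralOperator {T : Type*} [MeasurableSpace T] (k : T → T → ℝ) (μ : Measure T)
    (A : Lp ℝ 2 μ →L[ℝ] Lp ℝ 2 μ) : Prop :=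
  ∀ f : Lp ℝ 2 μ,
    (∀ᵐ s ∂μ, Integrable (fun t => k t s * f t) μ) ∧
    (A f : T → ℝ) =ᵐ[μ] fun s => ∫ t, k t s * f t ∂μ

/-- Existence of the conditional expectation operator: a bounded operator
`E : L₂(P(dx)) → L₂(P(dz))` with `(E f)(z) = 𝔼[f(x) | σ(z)]` almost surely. -/
theorem exists_condExpOperator {Ω X Z : Type*} [MeasurableSpace Ω] [MeasurableSpace X]
    [mZ : MeasurableSpace Z] (P : Measure Ω) [IsProbabilityMeasure P] {x : Ω → X} {z : Ω → Z}
    (hx : Measurable x) (hz : Measurable z) :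
    ∃ E : Lp ℝ 2 (P.map x) →L[ℝ] Lp ℝ 2 (P.map z), ∀ f : Lp ℝ 2 (P.map x),
      (fun ω => E f (z ω)) =ᵐ[P] P[fun ω => f (x ω) | mZ.comap z] := by
  have mpx : MeasurePreserving x P (P.map x) := ⟨hx, rfl⟩
  have mpz : MeasurePreserving z P (P.map z) := ⟨hz, rfl⟩
  have : IsProbabilityMeasure (P.map z) := Measure.isProbabilityMeasure_map hz.aemeasurable
  let Cx : Lp ℝ 2 (P.map x) →L[ℝ] Lp ℝ 2 P :=
    (Lp.compMeasurePreservingₗᵢ ℝ x mpx).toContinuousLinearMap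
  let Cz : Lp ℝ 2 (P.map z) →L[ℝ] Lp ℝ 2 P :=
    (Lp.compMeasurePreservingₗᵢ ℝ z mpz).toContinuousLinearMap
  have hCx : ∀ f, (Cx f : Ω → ℝ) =ᵐ[P] fun ω => f (x ω) := fun f =>
    Lp.coeFn_compMeasurePreserving f mpx
  have hCz : ∀ f, (Cz f : Ω → ℝ) =ᵐ[P] fun ω => f (z ω) := fun f =>
    Lp.coeFn_compMeasurePreserving f mpz
  refine ⟨(ContinuousLinearMap.adjoint Cz) ∘L Cx, fun f => ?_⟩
  have hint : ∀ g : Lp ℝ 2 P, Integrable g P := fun g => (Lp.memLp g).integrable one_le_two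
  refine ae_eq_condExp_of_forall_setIntegral_eq hz.comap_le ((hint (Cx f)).congr (hCx f))
    (fun s _ _ => (((hint (Cz _)).congr (hCz _)).integrableOn)) ?_ ?_
  · rintro s ⟨t, ht, rfl⟩ -
    set g := ((ContinuousLinearMap.adjoint Cz) ∘L Cx) f with hg
    let i : Lp ℝ 2 (P.map z) := indicatorConstLp 2 ht (measure_ne_top _ _) (1 : ℝ)
    have hi : Cz i = indicatorConstLp 2 (hz ht) (measure_ne_top _ _) (1 : ℝ) :=
      Lp.indicatorConstLp_compMeasurePreserving ht (measure_ne_top _ _) 1 mpz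
    have h1 : inner ℝ (Cz i) (Cz g) = inner ℝ (Cz i) (Cx f) := by
      have : inner ℝ (Cz i) (Cz g) = inner ℝ i g :=
        (Lp.compMeasurePreservingₗᵢ ℝ z mpz).inner_map_map i g
      rw [this, hg, ContinuousLinearMap.comp_apply, ContinuousLinearMap.adjoint_inner_right]
    rw [hi, L2.inner_indicatorConstLp_one, L2.inner_indicatorConstLp_one] at h1
    rw [setIntegral_congr_ae (hz ht) ((hCz g).mono fun ω h _ => h),
      setIntegral_congr_ae (hz ht) ((hCx f).mono fun ω h _ => h)] at h1
    exact h1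
  · exact ((Lp.stronglyMeasurable _).comp_measurable
      (comap_measurable z)).aestronglyMeasurable

/-- The conditional expectation operator `E : L₂(P(dx)) → L₂(P(dz))`,
`f ↦ 𝔼[f(x) | z = ·]`; it is uniquely determined by the defining property. -/
def condExpOperator {Ω X Z : Type*} [MeasurableSpace Ω] [MeasurableSpace X]
    [MeasurableSpace Z] (P : Measure Ω) [IsProbabilityMeasure P] {x : Ω → X} {z : Ω → Z}
    (hx : Measurable x) (hz : Measurable z) :
    Lp ℝ 2 (P.map x) →L[ℝ] Lp ℝ 2 (P.map z) :=
  (exists_condExpOperator P hx hz).choose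

theorem condExpOperator_ae_eq {Ω X Z : Type*} [MeasurableSpace Ω] [MeasurableSpace X]
    [mZ : MeasurableSpace Z] (P : Measure Ω) [IsProbabilityMeasure P] {x : Ω → X} {z : Ω → Z}
    (hx : Measurable x) (hz : Measurable z) (f : Lp ℝ 2 (P.map x)) :
    (fun ω => condExpOperator P hx hz f (z ω))
      =ᵐ[P] P[fun ω => f (x ω) | mZ.comap z] :=
  (exists_condExpOperator P hx hz).choose_spec f

/-- `f ∼ GP(0, k)` on the probability space `(Ω, Q)`: a jointly measurable process
`(f t)_{t ∈ T}` whose finite-dimensional marginals are Gaussian, with mean zero and covariance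
`k`. Joint measurability is what makes `[f]∼` a random element of `L₂`. -/
structure IsCenteredGP {T Ω : Type*} [MeasurableSpace T] [MeasurableSpace Ω]
    (k : T → T → ℝ) (f : T → Ω → ℝ) (Q : Measure Ω) : Prop where
  measurable : Measurable fun p : T × Ω => f p.1 p.2
  gaussian : IsGaussianProcess f Q
  mean_zero : ∀ t, ∫ ω, f t ω ∂Q = 0
  covariance_eq : ∀ s t, cov[f s, f t; Q] = k s t

open Classical in
/-- The `L₂(μ)` equivalence class `[g]∼` of a square integrable function `g` (and `0` if `g` is
not square integrable). -/
def l2Class {T : Type*} [MeasurableSpace T] (μ : Measure T) (g : T → ℝ) : Lp ℝ 2 μ :=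
  if h : MemLp g 2 μ then h.toLp g else 0

/-- `L₂(μ)` carries its Borel `σ`-algebra. -/
instance instMeasurableSpaceL2 {T : Type*} [MeasurableSpace T] (μ : Measure T) :
    MeasurableSpace (Lp ℝ 2 μ) := borel _

instance instBorelSpaceL2 {T : Type*} [MeasurableSpace T] (μ : Measure T) :
    BorelSpace (Lp ℝ 2 μ) := ⟨rfl⟩

end

/-! Write `kx s t = ⟪φ s, φ t⟫` with a feature map `φ` into a Hilbert space `H`; boundedness and
continuity of `kx` make `φ` bounded and continuous. The `H`-valued conditional expectation of `φ(x)`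
given `z` has the form `ψ(z)`, and `kz s t = ⟪ψ s, ψ t⟫` is the required kernel.

For the operators, put `S_φ h = ⟪h, φ(·)⟫`. Then `Tx = S_φ S_φᵀ`, and `E S_φ = S_ψ` because bounded
functionals commute with conditional expectation. Hence `E Tx Eᵀ = S_ψ S_ψᵀ`, the integral operator
of `kz`.

For the laws, `⟪u, [g]⟫` is centered Gaussian with variance `⟪u, Tz u⟫`, while `⟪u, E[f]⟫ = ⟪Eᵀu,
[f]⟫` has variance `⟪Eᵀu, Tx Eᵀu⟫`, the same number (`IsCenteredGP.map_inner_l2Class`).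
One-dimensional projections determine the law of a random element with almost surely separable range
(`identDistrib_of_inner`). Gaussianity of a projection holds because it lies in the `L₂` closure of
the span of the process, and Gaussian laws survive `L₂` limits.

A process with covariance `kz` is `W (ψ z)` for an isonormal process `W` on `H`; strong
measurability of `ψ` yields a jointly measurable version. -/

noncomputable section

open Filter Topology

/-! ### Gaussian laws under `L₂` limits and linear maps -/

namespace ProbabilityTheory

variable {Ω : Type*} [MeasurableSpace Ω] {Q : Measure Ω}

/-- The random variables with a Gaussian law form a closed subset of `L₂`. -/
theorem isClosed_setOf_hasGaussianLaw [IsProbabilityMeasure Q] :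
    IsClosed {Y : Lp ℝ 2 Q | HasGaussianLaw Y Q} := by
  have hint : ∀ Y : Lp ℝ 2 Q, Integrable Y Q := fun Y => (Lp.memLp Y).integrable one_le_two
  let e : Lp ℝ 2 Q := indicatorConstLp 2 MeasurableSet.univ (measure_ne_top _ _) (1 : ℝ)
  have he : ∀ Y : Lp ℝ 2 Q, ∫ ω, Y ω ∂Q = inner ℝ e Y := fun Y => by
    rw [L2.inner_indicatorConstLp_one, setIntegral_univ]
  have hsq : ∀ Y : Lp ℝ 2 Q, ∫ ω, Y ω ^ 2 ∂Q = inner ℝ Y Y := fun Y => by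
    rw [L2.inner_def]
    exact integral_congr_ae (ae_of_all _ fun ω => by simp [sq])
  -- Lipschitz in `Y` with constant `|t|`: `|exp(ia) - 1| ≤ |a|`, and the `L₁` norm is at most the
  -- `L₂` norm under a probability measure.
  have hchar : ∀ t : ℝ, Continuous fun Y : Lp ℝ 2 Q => ∫ ω, Complex.exp (Complex.I * ↑(t * Y ω)) ∂Q := by
    intro t
    have hmeas : ∀ Y : Lp ℝ 2 Q, Integrable (fun ω => Complex.exp (Complex.I * ↑(t * Y ω))) Q := by
      intro Y
      have hY : Measurable Y := (Lp.stronglyMeasurable Y).measurable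
      refine Integrable.of_bound (C := 1) (by fun_prop) (ae_of_all _ fun ω => ?_)
      rw [mul_comm, Complex.norm_exp_ofReal_mul_I]
    refine (LipschitzWith.of_dist_le_mul (K := ‖t‖₊) fun Y Y' => ?_).continuous
    rw [dist_eq_norm, ← integral_sub (hmeas Y) (hmeas Y')]
    calc ‖∫ ω, (Complex.exp (Complex.I * ↑(t * Y ω)) - Complex.exp (Complex.I * ↑(t * Y' ω))) ∂Q‖
        ≤ ∫ ω, ‖t‖ * ‖(Y - Y' : Lp ℝ 2 Q) ω‖ ∂Q := by
          refine norm_integral_le_of_norm_le ((hint (Y - Y')).norm.const_mul _) ?_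
          filter_upwards [Lp.coeFn_sub Y Y'] with ω hω
          have h1 : Complex.exp (Complex.I * ↑(t * Y ω)) - Complex.exp (Complex.I * ↑(t * Y' ω))
              = Complex.exp (↑(t * Y' ω) * Complex.I) *
                (Complex.exp (Complex.I * ↑(t * (Y ω - Y' ω))) - 1) := by
            rw [mul_sub, ← Complex.exp_add, mul_one, mul_comm (Complex.ofReal _) Complex.I]
            congr 2
            push_cast
            ring
          rw [h1, norm_mul, Complex.norm_exp_ofReal_mul_I, one_mul, hω, Pi.sub_apply, ← norm_mul]
          exact Real.norm_exp_I_mul_ofReal_sub_one_le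
      _ = ‖t‖ * (eLpNorm (Y - Y' : Lp ℝ 2 Q) 1 Q).toReal := by
          rw [integral_const_mul, integral_norm_eq_lintegral_enorm (hint (Y - Y')).1,
            eLpNorm_one_eq_lintegral_enorm]
      _ ≤ ‖t‖ * dist Y Y' := by
          rw [dist_eq_norm, Lp.norm_def]
          gcongr
          · exact Lp.eLpNorm_ne_top _
          · exact eLpNorm_le_eLpNorm_of_exponent_le one_le_two (hint (Y - Y')).1
  -- `Y` is Gaussian iff its characteristic function is the Gaussian one with its own mean `⟪e, Y⟫`
  -- and variance `⟪Y, Y⟫ - ⟪e, Y⟫²`. Both sides are continuous in `Y`.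
  have key : {Y : Lp ℝ 2 Q | HasGaussianLaw Y Q} = ⋂ t : ℝ, {Y : Lp ℝ 2 Q |
      ∫ ω, Complex.exp (Complex.I * ↑(t * Y ω)) ∂Q = Complex.exp (↑(t * inner ℝ e Y) * Complex.I -
        ↑(t ^ 2 * (inner ℝ Y Y - inner ℝ e Y ^ 2)) / 2)} := by
    ext Y
    have hY : Measurable Y := (Lp.stronglyMeasurable Y).measurable
    simp only [Set.mem_ofPred_eq, Set.mem_iInter]
    rw [hasGaussianLaw_iff_charFun_map_eq hY.aemeasurable]
    refine forall_congr' fun t => ?_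
    have h1 : charFun (Q.map Y) t = ∫ ω, Complex.exp (Complex.I * ↑(t * Y ω)) ∂Q := by
      rw [charFun_apply, integral_map hY.aemeasurable (by fun_prop)]
      exact integral_congr_ae (ae_of_all _ fun ω => by simp [mul_comm])
    have h2 : Q[fun ω => (inner ℝ t (Y ω) : ℝ)] = t * inner ℝ e Y := by
      rw [← he, ← integral_const_mul]
      exact integral_congr_ae (ae_of_all _ fun ω => by simp [mul_comm])
    have h3 : Var[fun ω => (inner ℝ t (Y ω) : ℝ); Q] = t ^ 2 * (inner ℝ Y Y - inner ℝ e Y ^ 2) := by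
      have : (fun ω => (inner ℝ t (Y ω) : ℝ)) = fun ω => t * Y ω := by
        ext ω; simp [mul_comm]
      rw [this, variance_const_mul, variance_eq_sub (Lp.memLp Y), ← he, ← hsq]
      rfl
    rw [h1, h2, h3]
  rw [key]
  refine isClosed_iInter fun t => isClosed_eq (hchar t) ?_
  fun_prop

/-- Square integrable random variables in the closed linear span of a Gaussian process have a
Gaussian law. -/
theorem IsGaussianProcess.hasGaussianLaw_of_mem_closure_span {T : Type*} {X : T → Ω → ℝ}
    (hX : IsGaussianProcess X Q) {e : T → Lp ℝ 2 Q} (he : ∀ t, e t =ᵐ[Q] X t) {Y : Lp ℝ 2 Q}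
    (hY : Y ∈ (Submodule.span ℝ (Set.range e)).topologicalClosure) : HasGaussianLaw Y Q := by
  have : IsProbabilityMeasure Q := hX.isProbabilityMeasure
  refine closure_minimal ?_ isClosed_setOf_hasGaussianLaw hY
  intro Y hY
  obtain ⟨c, rfl⟩ := Finsupp.mem_span_range_iff_exists_finsupp.1 hY
  refine ((hX.smul (c ·)).hasGaussianLaw_fun_sum (I := c.support)).congr ?_
  have h1 : ∀ᵐ ω ∂Q, ∀ t ∈ c.support, (c t • e t : Lp ℝ 2 Q) ω = c t • X t ω := by
    refine (ae_ball_iff c.support.countable_toSet).2 fun t _ => ?_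
    filter_upwards [Lp.coeFn_smul (c t) (e t), he t] with ω h1 h2
    rw [h1, Pi.smul_apply, h2]
  filter_upwards [h1, Lp.coeFn_finsetSum c.support fun t => c t • e t] with ω h1 h2
  rw [Finsupp.sum, h2, Finset.sum_apply]
  exact Finset.sum_congr rfl fun t ht => (h1 t ht).symm

/-- A linear family of Gaussian random variables is a Gaussian process. -/
theorem isGaussianProcess_of_linear {H : Type*} [AddCommGroup H] [Module ℝ H]
    (W : H →ₗ[ℝ] Lp ℝ 2 Q) (hW : ∀ h, HasGaussianLaw (W h) Q) :
    IsGaussianProcess (fun h => (W h : Ω → ℝ)) Q := by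
  classical
  have : IsProbabilityMeasure Q := (hW 0).isProbabilityMeasure
  refine ⟨fun I => ⟨⟨fun L => ?_⟩⟩⟩
  have hm : ∀ h, Measurable (W h) := fun h => (Lp.stronglyMeasurable _).measurable
  have hmI : Measurable fun ω => I.restrict fun h => W h ω := measurable_pi_lambda _ fun i => hm i
  -- By linearity of `W`, a functional of finitely many values of `W` is again a single value of
  -- `W`, hence Gaussian.
  have hL : (fun ω => L (I.restrict fun h => W h ω)) =ᵐ[Q]
      W (∑ i : I, L (Pi.single i 1) • (i : H)) := by
    rw [map_sum]
    have h1 : ∀ᵐ ω ∂Q, ∀ i : I, W (L (Pi.single i 1) • (i : H)) ω = L (Pi.single i 1) * W i ω := by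
      refine ae_all_iff.2 fun i => ?_
      rw [map_smul]
      filter_upwards [Lp.coeFn_smul (L (Pi.single i 1)) (W i)] with ω h
      rw [h, Pi.smul_apply, smul_eq_mul]
    filter_upwards [h1, Lp.coeFn_finsetSum Finset.univ
      fun i : I => W (L (Pi.single i 1) • (i : H))] with ω h1 h2
    rw [h2, Finset.sum_apply, ← ContinuousLinearMap.coe_coe, LinearMap.pi_apply_eq_sum_univ]
    refine Finset.sum_congr rfl fun i _ => ?_
    refine Eq.trans ?_ (h1 i).symm
    rw [smul_eq_mul, mul_comm]
    congr 1
    refine congrArg L ?_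
    ext j
    simp [Pi.single_apply, eq_comm]
  have h3 := (hW (∑ i : I, L (Pi.single i 1) • (i : H))).congr hL.symm
  have h4 : (Q.map fun ω => I.restrict fun h => W h ω).map L
      = Q.map fun ω => L (I.restrict fun h => W h ω) :=
    Measure.map_map (by fun_prop) hmI
  have h5 := h3.map_eq_gaussianReal
  rw [h4, h5, integral_map hmI.aemeasurable (by fun_prop), variance_map (by fun_prop) hmI.aemeasurable]
  rfl

end ProbabilityTheory

/-! ### Linearity and continuity of the class map into `L₂` -/

section L2Class

variable {T : Type*} [MeasurableSpace T] {μ : Measure T}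

theorem l2Class_of_memLp {f : T → ℝ} (hf : MemLp f 2 μ) : l2Class μ f = hf.toLp f := dif_pos hf

theorem l2Class_add {f g : T → ℝ} (hf : MemLp f 2 μ) (hg : MemLp g 2 μ) :
    l2Class μ (f + g) = l2Class μ f + l2Class μ g := by
  rw [l2Class_of_memLp hf, l2Class_of_memLp hg, l2Class_of_memLp (hf.add hg), MemLp.toLp_add]

theorem l2Class_sub {f g : T → ℝ} (hf : MemLp f 2 μ) (hg : MemLp g 2 μ) :
    l2Class μ (f - g) = l2Class μ f - l2Class μ g := by
  rw [l2Class_of_memLp hf, l2Class_of_memLp hg, l2Class_of_memLp (hf.sub hg), MemLp.toLp_sub]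

theorem l2Class_const_smul {f : T → ℝ} (c : ℝ) (hf : MemLp f 2 μ) :
    l2Class μ (c • f) = c • l2Class μ f := by
  rw [l2Class_of_memLp hf, l2Class_of_memLp (hf.const_smul c), MemLp.toLp_const_smul]

theorem l2Class_zero : l2Class μ (0 : T → ℝ) = 0 := by
  rw [l2Class_of_memLp MemLp.zero, MemLp.toLp_zero]

theorem l2Class_sum {ι : Type*} (I : Finset ι) {f : ι → T → ℝ} (hf : ∀ i, MemLp (f i) 2 μ) :
    l2Class μ (∑ i ∈ I, f i) = ∑ i ∈ I, l2Class μ (f i) := by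
  classical
  induction I using Finset.induction_on with
  | empty => simpa using l2Class_zero
  | insert i I hi ih =>
    rw [Finset.sum_insert hi, Finset.sum_insert hi, l2Class_add (hf i) (memLp_finsetSum' I
      fun i _ => hf i), ih]

/-- Dominated convergence in `L₂`. -/
theorem tendsto_l2Class {f : T → ℝ} {s : ℕ → T → ℝ} {G : T → ℝ} (hG : MemLp G 2 μ)
    (hs : ∀ n, AEStronglyMeasurable (s n) μ) (hb : ∀ n, ∀ᵐ t ∂μ, ‖s n t‖ ≤ G t)
    (hlim : ∀ᵐ t ∂μ, Tendsto (fun n => s n t) atTop (𝓝 (f t))) :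
    Tendsto (fun n => l2Class μ (s n)) atTop (𝓝 (l2Class μ f)) := by
  have hfm : AEStronglyMeasurable f μ := aestronglyMeasurable_of_tendsto_ae atTop hs hlim
  have hb' : ∀ᵐ t ∂μ, ∀ n, ‖s n t‖ ≤ G t := ae_all_iff.2 hb
  have hfb : ∀ᵐ t ∂μ, ‖f t‖ ≤ G t := by
    filter_upwards [hb', hlim] with t h1 h2
    exact le_of_tendsto h2.norm (Eventually.of_forall h1)
  have hsL : ∀ n, MemLp (s n) 2 μ := fun n => hG.mono (hs n) <| by
    filter_upwards [hb n] with t h using h.trans (le_abs_self _)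
  have hfL : MemLp f 2 μ := hG.mono hfm <| by
    filter_upwards [hfb] with t h using h.trans (le_abs_self _)
  simp_rw [l2Class_of_memLp (hsL _), l2Class_of_memLp hfL]
  rw [Lp.tendsto_Lp_iff_tendsto_eLpNorm'']
  have h1 : Tendsto (fun n => ∫⁻ t, ‖s n t - f t‖ₑ ^ (2 : ℝ) ∂μ) atTop (𝓝 (∫⁻ _, 0 ∂μ)) := by
    refine tendsto_lintegral_of_dominated_convergence' (fun t => ‖(2 : ℝ) * G t‖ₑ ^ (2 : ℝ))
      (fun n => (((hs n).sub hfm).enorm.pow_const _)) ?_ ?_ ?_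
    · intro n
      filter_upwards [hb', hfb] with t h1 h2
      gcongr
      rw [enorm_le_iff_norm_le]
      refine (norm_sub_le _ _).trans (le_trans ?_ (le_abs_self _))
      linarith [h1 n]
    · have := (hG.const_mul 2).eLpNorm_lt_top
      rw [eLpNorm_lt_top_iff_lintegral_rpow_enorm_lt_top two_ne_zero ENNReal.ofNat_ne_top] at this
      simpa using this.ne
    · filter_upwards [hlim] with t ht
      have : Tendsto (fun n => ‖s n t - f t‖ₑ) atTop (𝓝 0) := by
        simpa using (ht.sub_const (f t)).enorm
      simpa [Function.comp_def] using
        ((ENNReal.continuous_rpow_const (y := 2)).tendsto _).comp this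
  simp_rw [eLpNorm_eq_lintegral_rpow_enorm_toReal two_ne_zero ENNReal.ofNat_ne_top]
  simp only [lintegral_zero] at h1
  simpa [Function.comp_def] using ((ENNReal.continuous_rpow_const (y := 1 / 2)).tendsto _).comp h1

end L2Class

/-! ### Measurability of the path map -/

section PathMap

variable {T Ω : Type*} [MeasurableSpace T] [MeasurableSpace Ω] {μ : Measure T} {Q : Measure Ω}

/-- `L₂(μ)` need not be separable, so strong measurability is what has to be tracked. A π-λ argument
applies: on a rectangle `B ×ˢ C` the path map takes only the two values `[1_B]` and `0`; complements
are differences, and disjoint unions are `L₂` limits of partial sums. -/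
theorem stronglyMeasurable_l2Class_indicator [IsFiniteMeasure μ] {A : Set (T × Ω)}
    (hA : MeasurableSet A) : StronglyMeasurable fun ω => l2Class μ fun t =>
      A.indicator (fun _ => (1 : ℝ)) (t, ω) := by
  have hL : ∀ {A : Set (T × Ω)}, MeasurableSet A → ∀ ω,
      MemLp (fun t => A.indicator (fun _ => (1 : ℝ)) (t, ω)) 2 μ := fun {A} hA ω => by
    refine MemLp.of_bound (C := 1) ?_ (ae_of_all _ fun t => ?_)
    · exact ((measurable_const.indicator hA).comp measurable_prodMk_right).aestronglyMeasurable
    · by_cases h : (t, ω) ∈ A <;> simp [h]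
  induction A, hA using MeasurableSpace.induction_on_inter generateFrom_prod.symm isPiSystem_prod with
  | empty => simpa using! stronglyMeasurable_const
  | basic A hA =>
    obtain ⟨B, hB, C, hC, rfl⟩ := hA
    have : (fun ω => l2Class μ fun t => (B ×ˢ C).indicator (fun _ => (1 : ℝ)) (t, ω))
        = C.indicator fun _ => l2Class μ (B.indicator fun _ => (1 : ℝ)) := by
      ext1 ω
      by_cases hω : ω ∈ C
      · simp only [hω, Set.indicator_of_mem]
        congr 1
        ext t
        by_cases ht : t ∈ B <;> simp [ht, hω]
      · simp only [hω, not_false_eq_true, Set.indicator_of_notMem]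
        rw [← l2Class_zero]
        congr 1
        ext t
        simp [hω]
    rw [this]
    exact stronglyMeasurable_const.indicator hC
  | compl A hA ih =>
    have : (fun ω => l2Class μ fun t => Aᶜ.indicator (fun _ => (1 : ℝ)) (t, ω)) =
        fun ω => l2Class μ (fun _ => 1) - l2Class μ fun t => A.indicator (fun _ => (1 : ℝ)) (t, ω) := by
      ext1 ω
      rw [← l2Class_sub (memLp_const 1) (hL hA ω)]
      congr 1
      ext t
      by_cases h : (t, ω) ∈ A <;> simp [h]
    rw [this]
    exact stronglyMeasurable_const.sub ih
  | iUnion A hd hA ih =>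
    refine stronglyMeasurable_of_tendsto atTop (f := fun n ω => ∑ i ∈ Finset.range n,
      l2Class μ fun t => (A i).indicator (fun _ => (1 : ℝ)) (t, ω))
      (fun n => Finset.stronglyMeasurable_fun_sum _ fun i _ => ih i) (tendsto_pi_nhds.2 fun ω => ?_)
    simp_rw [← l2Class_sum _ fun i => hL (hA i) ω]
    have hs : ∀ n t, (∑ i ∈ Finset.range n, fun t => (A i).indicator (fun _ => (1 : ℝ)) (t, ω)) t =
        (⋃ i ∈ Finset.range n, A i).indicator (fun _ => (1 : ℝ)) (t, ω) := by
      intro n t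
      rw [Finset.sum_apply, Finset.indicator_biUnion_apply]
      exact fun i _ j _ hij => hd hij
    refine tendsto_l2Class (memLp_const 1) (fun n => ?_) (fun n => ae_of_all _ fun t => ?_)
      (ae_of_all _ fun t => ?_)
    · exact (memLp_finsetSum' _ fun i _ => hL (hA i) ω).1
    · rw [hs]
      refine (norm_indicator_le_norm_self _ _).trans ?_
      simp
    · simp_rw [hs]
      by_cases h : ∃ i, (t, ω) ∈ A i
      · obtain ⟨i, hi⟩ := h
        refine tendsto_const_nhds.congr' ?_
        filter_upwards [eventually_gt_atTop i] with n hn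
        rw [Set.indicator_of_mem (Set.mem_iUnion.2 ⟨i, hi⟩),
          Set.indicator_of_mem (Set.mem_iUnion₂.2 ⟨i, Finset.mem_range.2 hn, hi⟩)]
      · refine tendsto_const_nhds.congr fun n => ?_
        rw [Set.indicator_of_notMem, Set.indicator_of_notMem]
        · simp only [Set.mem_iUnion, not_exists]
          exact fun i _ hi => h ⟨i, hi⟩
        · simpa using h

theorem stronglyMeasurable_l2Class_simpleFunc [IsFiniteMeasure μ] (s : SimpleFunc (T × Ω) ℝ) :
    StronglyMeasurable fun ω => l2Class μ fun t => s (t, ω) := by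
  have hL : ∀ (s : SimpleFunc (T × Ω) ℝ) ω, MemLp (fun t => s (t, ω)) 2 μ := fun s ω => by
    obtain ⟨C, hC⟩ := s.exists_forall_norm_le
    exact MemLp.of_bound (s.measurable.comp measurable_prodMk_right).aestronglyMeasurable C
      (ae_of_all _ fun t => hC _)
  induction s using SimpleFunc.induction with
  | const c hA =>
    rename_i A
    have h1 := (stronglyMeasurable_l2Class_indicator (μ := μ) hA).const_smul c
    convert! h1 using 1
    ext1 ω
    have hm : MemLp (fun t => A.indicator (fun _ => (1 : ℝ)) (t, ω)) 2 μ := by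
      simpa [SimpleFunc.coe_piecewise, Set.indicator, Set.piecewise] using
        hL (SimpleFunc.piecewise A hA (SimpleFunc.const _ 1) (SimpleFunc.const _ 0)) ω
    simp only [Pi.smul_apply]
    rw [← l2Class_const_smul c hm]
    congr 1
    ext t
    by_cases h : (t, ω) ∈ A <;> simp [h]
  | add hd h1 h2 =>
    rename_i f g
    convert! h1.add h2 using 1
    ext1 ω
    simp only [Pi.add_apply]
    rw [← l2Class_add (hL f ω) (hL g ω)]
    rfl

/-- The path map of a jointly measurable process with square integrable paths is a random element
of `L₂`, with values in a separable subspace. -/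
theorem aestronglyMeasurable_l2Class [IsFiniteMeasure μ] {f : T → Ω → ℝ}
    (hf : Measurable fun p : T × Ω => f p.1 p.2) (hL : ∀ᵐ ω ∂Q, MemLp (fun t => f t ω) 2 μ) :
    AEStronglyMeasurable (fun ω => l2Class μ fun t => f t ω) Q := by
  let s : ℕ → SimpleFunc (T × Ω) ℝ :=
    SimpleFunc.approxOn (fun p : T × Ω => f p.1 p.2) hf Set.univ 0 (Set.mem_univ _)
  refine aestronglyMeasurable_of_tendsto_ae atTop
    (fun n => (stronglyMeasurable_l2Class_simpleFunc (s n)).aestronglyMeasurable) ?_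
  filter_upwards [hL] with ω hω
  refine tendsto_l2Class (G := fun t => ‖f t ω‖ + ‖f t ω‖) (hω.norm.add hω.norm)
    (fun n => ((s n).measurable.comp measurable_prodMk_right).aestronglyMeasurable)
    (fun n => ae_of_all _ fun t => ?_) (ae_of_all _ fun t => ?_)
  · exact SimpleFunc.norm_approxOn_zero_le hf (Set.mem_univ _) (t, ω) n
  · exact SimpleFunc.tendsto_approxOn hf (Set.mem_univ _) (by simp)

end PathMap

/-! ### Paths of a Gaussian process and their `L₂` projections -/

namespace IsCenteredGP

variable {T Ω : Type*} [MeasurableSpace T] [MeasurableSpace Ω] {μ : Measure T} {Q : Measure Ω}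
  {k : T → T → ℝ} {f : T → Ω → ℝ}

theorem memLp_two (hf : IsCenteredGP k f Q) (t : T) : MemLp (f t) 2 Q :=
  (hf.gaussian.hasGaussianLaw_eval t).memLp_two

theorem integral_mul (hf : IsCenteredGP k f Q) (s t : T) : ∫ ω, f s ω * f t ω ∂Q = k s t := by
  have : IsProbabilityMeasure Q := hf.gaussian.isProbabilityMeasure
  rw [← hf.covariance_eq s t, covariance_eq_sub (hf.memLp_two s) (hf.memLp_two t), hf.mean_zero s]
  simp

/-- By Tonelli the squared norm is the integral of `𝔼[f_t²] = k t t`. -/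
theorem memLp_prod [IsFiniteMeasure μ] (hf : IsCenteredGP k f Q)
    (hk : Integrable (fun t => k t t) μ) : MemLp (fun p : T × Ω => f p.1 p.2) 2 (μ.prod Q) := by
  have : IsProbabilityMeasure Q := hf.gaussian.isProbabilityMeasure
  rw [memLp_two_iff_integrable_sq hf.measurable.aestronglyMeasurable,
    integrable_prod_iff (hf.measurable.pow_const 2).aestronglyMeasurable]
  refine ⟨ae_of_all _ fun t => (hf.memLp_two t).integrable_sq, hk.congr (ae_of_all _ fun t => ?_)⟩
  simp [← hf.integral_mul, sq]

/-- The sample paths are almost surely square integrable. -/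
theorem ae_memLp [IsFiniteMeasure μ] (hf : IsCenteredGP k f Q)
    (hk : Integrable (fun t => k t t) μ) : ∀ᵐ ω ∂Q, MemLp (fun t => f t ω) 2 μ := by
  have : IsProbabilityMeasure Q := hf.gaussian.isProbabilityMeasure
  filter_upwards [(hf.memLp_prod hk).integrable_sq.prod_left_ae] with ω hω
  exact (memLp_two_iff_integrable_sq
    (hf.measurable.comp measurable_prodMk_right).aestronglyMeasurable).2 hω

theorem aestronglyMeasurable_l2Class [IsFiniteMeasure μ] (hf : IsCenteredGP k f Q)
    (hk : Integrable (fun t => k t t) μ) :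
    AEStronglyMeasurable (fun ω => l2Class μ fun t => f t ω) Q :=
  _root_.aestronglyMeasurable_l2Class hf.measurable (hf.ae_memLp hk)

theorem memLp_l2Class [IsFiniteMeasure μ] (hf : IsCenteredGP k f Q)
    (hk : Integrable (fun t => k t t) μ) :
    MemLp (fun ω => l2Class μ fun t => f t ω) 2 Q := by
  have : IsProbabilityMeasure Q := hf.gaussian.isProbabilityMeasure
  rw [memLp_two_iff_integrable_sq_norm (hf.aestronglyMeasurable_l2Class hk)]
  refine (hf.memLp_prod hk).integrable_sq.integral_prod_right.congr ?_
  filter_upwards [hf.ae_memLp hk] with ω hω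
  rw [l2Class_of_memLp hω, ← real_inner_self_eq_norm_sq, L2.inner_def]
  refine integral_congr_ae ?_
  filter_upwards [hω.coeFn_toLp] with t ht
  simp [ht, sq]

theorem ae_inner_l2Class_eq [IsFiniteMeasure μ] (hf : IsCenteredGP k f Q)
    (hk : Integrable (fun t => k t t) μ) (u : Lp ℝ 2 μ) :
    ∀ᵐ ω ∂Q, inner ℝ u (l2Class μ fun t => f t ω) = ∫ t, u t * f t ω ∂μ := by
  filter_upwards [hf.ae_memLp hk] with ω hω
  rw [l2Class_of_memLp hω, L2.inner_def]
  refine integral_congr_ae ?_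
  filter_upwards [hω.coeFn_toLp] with t ht
  simp [ht, mul_comm]

/-- Fubini, legitimate because `u ⊗ ξ` and `f` are both square integrable on the product. The
choices `ξ = 1`, `ξ = f t`, `ξ = Y` and `ξ` orthogonal to the process give the mean, the
covariances, the variance and the span membership of a projection `Y`. -/
theorem integral_mul_inner_l2Class [IsFiniteMeasure μ] (hf : IsCenteredGP k f Q)
    (hk : Integrable (fun t => k t t) μ) (u : Lp ℝ 2 μ) {ξ : Ω → ℝ} (hξ : MemLp ξ 2 Q) :
    ∫ ω, ξ ω * inner ℝ u (l2Class μ fun t => f t ω) ∂Q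
      = ∫ t, u t * ∫ ω, ξ ω * f t ω ∂Q ∂μ := by
  have : IsProbabilityMeasure Q := hf.gaussian.isProbabilityMeasure
  have h1 : MemLp (fun p : T × Ω => u p.1 * ξ p.2) 2 (μ.prod Q) := by
    refine (memLp_two_iff_integrable_sq
      ((Lp.aestronglyMeasurable u).comp_fst.mul hξ.1.comp_snd)).2 ?_
    simpa only [Pi.mul_apply, mul_pow] using (Lp.memLp u).integrable_sq.mul_prod hξ.integrable_sq
  have h2 : Integrable (Function.uncurry fun t ω => u t * (ξ ω * f t ω)) (μ.prod Q) := by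
    refine (h1.integrable_mul (hf.memLp_prod hk)).congr (ae_of_all _ fun p => ?_)
    simp [Function.uncurry, mul_assoc]
  calc ∫ ω, ξ ω * inner ℝ u (l2Class μ fun t => f t ω) ∂Q
      = ∫ ω, ∫ t, u t * (ξ ω * f t ω) ∂μ ∂Q := by
        refine integral_congr_ae ?_
        filter_upwards [hf.ae_inner_l2Class_eq hk u] with ω hω
        rw [hω, ← integral_const_mul]
        simp only [mul_left_comm]
    _ = ∫ t, ∫ ω, u t * (ξ ω * f t ω) ∂Q ∂μ := (integral_integral_swap h2).symm
    _ = _ := by simp only [integral_const_mul]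

/-- The law of the `L₂` inner product of a fixed function with the path of a Gaussian process. -/
theorem map_inner_l2Class [IsFiniteMeasure μ] (hf : IsCenteredGP k f Q)
    (hk : Integrable (fun t => k t t) μ) {A : Lp ℝ 2 μ →L[ℝ] Lp ℝ 2 μ}
    (hA : IsIntegralOperator k μ A) (u : Lp ℝ 2 μ) :
    Q.map (fun ω => inner ℝ u (l2Class μ fun t => f t ω))
      = gaussianReal 0 (inner ℝ u (A u)).toNNReal := by
  have : IsProbabilityMeasure Q := hf.gaussian.isProbabilityMeasure
  set Y : Ω → ℝ := fun ω => inner ℝ u (l2Class μ fun t => f t ω) with hY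
  have hYL : MemLp Y 2 Q := (hf.memLp_l2Class hk).const_inner u
  have hmean : ∫ ω, Y ω ∂Q = 0 := by
    simpa [hf.mean_zero] using hf.integral_mul_inner_l2Class hk u (memLp_const (1 : ℝ))
  have hYf : ∀ t, ∫ ω, Y ω * f t ω ∂Q = ∫ s, k s t * u s ∂μ := fun t => by
    simp_rw [mul_comm (Y _), hY, hf.integral_mul_inner_l2Class hk u (hf.memLp_two t), mul_comm (u _)]
    refine integral_congr_ae (ae_of_all _ fun s => ?_)
    simp only
    rw [← hf.integral_mul s t]
    simp_rw [mul_comm (f t _)]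
  have hvar : Var[Y; Q] = inner ℝ u (A u) := by
    rw [variance_of_integral_eq_zero hYL.1.aemeasurable hmean, L2.inner_def]
    simp_rw [sq]
    rw [show (∫ ω, Y ω * Y ω ∂Q) = ∫ ω, Y ω * inner ℝ u (l2Class μ fun t => f t ω) ∂Q from rfl,
      hf.integral_mul_inner_l2Class hk u hYL]
    simp_rw [hYf]
    refine integral_congr_ae ?_
    filter_upwards [(hA u).2] with t ht
    simp [ht, mul_comm]
  let e : T → Lp ℝ 2 Q := fun t => (hf.memLp_two t).toLp
  -- By the double orthogonal complement it suffices that each `ξ` orthogonal to every `f t` is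
  -- orthogonal to `Y`, which is read off from the Fubini identity.
  have hmem : hYL.toLp Y ∈ (Submodule.span ℝ (Set.range e)).topologicalClosure := by
    rw [← Submodule.orthogonal_orthogonal_eq_closure, Submodule.mem_orthogonal]
    intro ξ hξ
    have h0 : ∀ t, ∫ ω, ξ ω * f t ω ∂Q = 0 := fun t => by
      have := (Submodule.mem_orthogonal _ _).1 hξ (e t) (Submodule.subset_span ⟨t, rfl⟩)
      rw [L2.inner_def] at this
      rw [← this]
      refine integral_congr_ae ?_
      filter_upwards [(hf.memLp_two t).coeFn_toLp] with ω hω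
      simp [e, hω]
    have h1 := hf.integral_mul_inner_l2Class hk u (Lp.memLp ξ)
    simp only [h0, mul_zero, integral_zero] at h1
    rw [L2.inner_def, ← h1]
    refine integral_congr_ae ?_
    filter_upwards [hYL.coeFn_toLp] with ω hω
    simp only [hω, RCLike.inner_apply, conj_trivial]
    exact mul_comm _ _
  have hG : HasGaussianLaw Y Q :=
    (hf.gaussian.hasGaussianLaw_of_mem_closure_span (fun t => (hf.memLp_two t).coeFn_toLp)
      hmem).congr hYL.coeFn_toLp
  rw [hG.map_eq_gaussianReal, hmean, hvar]

end IsCenteredGP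

/-! ### Projections determine the law -/

/-- Two random elements of a Hilbert space, with separable ranges, have the same law if their
one-dimensional projections do. -/
theorem identDistrib_of_inner {Ω₁ Ω₂ V : Type*} [MeasurableSpace Ω₁] [MeasurableSpace Ω₂]
    [NormedAddCommGroup V] [InnerProductSpace ℝ V] [CompleteSpace V] [MeasurableSpace V]
    [BorelSpace V] {Q₁ : Measure Ω₁} {Q₂ : Measure Ω₂} [IsFiniteMeasure Q₁] [IsFiniteMeasure Q₂]
    {Y₁ : Ω₁ → V} {Y₂ : Ω₂ → V} (h₁ : AEStronglyMeasurable Y₁ Q₁)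
    (h₂ : AEStronglyMeasurable Y₂ Q₂)
    (h : ∀ v, Q₁.map (fun ω => inner ℝ v (Y₁ ω)) = Q₂.map fun ω => inner ℝ v (Y₂ ω)) :
    IdentDistrib Y₁ Y₂ Q₁ Q₂ := by
  obtain ⟨t₁, ht₁, hY₁⟩ := h₁.isSeparable_ae_range
  obtain ⟨t₂, ht₂, hY₂⟩ := h₂.isSeparable_ae_range
  -- Both elements lie almost surely in the closed separable subspace `K`, where characteristic
  -- functions determine finite measures. The laws are compared there and pushed back to `V` by the
  -- inclusion.
  let K : Submodule ℝ V := (Submodule.span ℝ (t₁ ∪ t₂)).topologicalClosure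
  have hK : TopologicalSpace.IsSeparable (K : Set V) := by
    rw [Submodule.topologicalClosure_coe]
    exact ((ht₁.union ht₂).span (R := ℝ)).closure
  have : TopologicalSpace.SeparableSpace K := hK.separableSpace
  have : SecondCountableTopology K := UniformSpace.secondCountable_of_separable K
  have : CompleteSpace K := (Submodule.isClosed_topologicalClosure _).completeSpace_coe
  have htK : t₁ ∪ t₂ ⊆ K := Submodule.subset_span.trans (Submodule.le_topologicalClosure _)
  have hp : ∀ v ∈ K, (K.orthogonalProjectionOnto v : V) = v := fun v hv =>
    Submodule.starProjection_eq_self_iff.2 hv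
  have hm : Measurable K.orthogonalProjectionOnto := K.orthogonalProjectionOnto.continuous.measurable
  have hm₁ := hm.comp_aemeasurable h₁.aemeasurable
  have hm₂ := hm.comp_aemeasurable h₂.aemeasurable
  have key : IdentDistrib (K.orthogonalProjectionOnto ∘ Y₁) (K.orthogonalProjectionOnto ∘ Y₂)
      Q₁ Q₂ := by
    refine ⟨hm₁, hm₂, Measure.ext_of_charFun (funext fun v => ?_)⟩
    have h1 : ∀ w : V, (inner ℝ (K.orthogonalProjectionOnto w) v : ℝ) = inner ℝ (v : V) w :=
      fun w => by
        rw [real_inner_comm, Submodule.inner_orthogonalProjectionOnto_eq_of_mem_left]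
    rw [charFun_apply, charFun_apply, integral_map hm₁ (by fun_prop), integral_map hm₂ (by fun_prop)]
    simp only [Function.comp_apply, h1]
    have h3 := integral_map (f := fun r : ℝ => Complex.exp (r * Complex.I))
      ((h₁.const_inner (𝕜 := ℝ) (c := (v : V))).aemeasurable) (by fun_prop)
    have h4 := integral_map (f := fun r : ℝ => Complex.exp (r * Complex.I))
      ((h₂.const_inner (𝕜 := ℝ) (c := (v : V))).aemeasurable) (by fun_prop)
    rw [← h3, ← h4, h]
  have hc := key.comp (u := ((↑) : K → V)) measurable_subtype_coe
  have e₁ : ((↑) : K → V) ∘ K.orthogonalProjectionOnto ∘ Y₁ =ᵐ[Q₁] Y₁ := by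
    filter_upwards [hY₁] with ω hω using hp _ (htK (Or.inl hω))
  have e₂ : ((↑) : K → V) ∘ K.orthogonalProjectionOnto ∘ Y₂ =ᵐ[Q₂] Y₂ := by
    filter_upwards [hY₂] with ω hω using hp _ (htK (Or.inr hω))
  exact ⟨h₁.aemeasurable, h₂.aemeasurable, by
    rw [← Measure.map_congr e₁, ← Measure.map_congr e₂, hc.map_eq]⟩

/-! ### Isonormal processes and jointly measurable versions -/

namespace ProbabilityTheory

/-- Existence of an isonormal Gaussian process on a real Hilbert space. -/
theorem exists_isonormal (H : Type*) [NormedAddCommGroup H] [InnerProductSpace ℝ H]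
    [CompleteSpace H] : ∃ (w : Set H) (Q : Measure (w → ℝ)) (_ : IsProbabilityMeasure Q)
      (W : H →ₗᵢ[ℝ] Lp ℝ 2 Q), ∀ h, HasGaussianLaw (W h) Q ∧ ∫ ω, W h ω ∂Q = 0 := by
  classical
  obtain ⟨w, b, -⟩ := exists_hilbertBasis ℝ H
  let Q : Measure (w → ℝ) := Measure.infinitePi fun _ => gaussianReal 0 1
  have hlaw : ∀ i : w, HasLaw (fun ω : w → ℝ => ω i) (gaussianReal 0 1) Q := fun i =>
    ⟨(measurable_pi_apply i).aemeasurable,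
      (measurePreserving_eval_infinitePi (fun _ : w => gaussianReal 0 1) i).map_eq⟩
  have hind : iIndepFun (fun (i : w) (ω : w → ℝ) => ω i) Q :=
    iIndepFun_infinitePi (P := fun _ : w => gaussianReal 0 1) (X := fun _ r => r)
      fun _ => measurable_id
  have hG : IsGaussianProcess (fun (i : w) (ω : w → ℝ) => ω i) Q :=
    ⟨fun I => (hind.precomp (g := ((↑) : I → w)) Subtype.val_injective).hasGaussianLaw
      fun i => (hlaw i).hasGaussianLaw⟩
  have hL : ∀ i : w, MemLp (fun ω : w → ℝ => ω i) 2 Q := fun i =>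
    (hG.hasGaussianLaw_eval i).memLp_two
  have hmean : ∀ i : w, ∫ ω : w → ℝ, ω i ∂Q = 0 := fun i => by
    rw [(hlaw i).integral_eq]
    simp
  have hvar : ∀ i : w, ∫ ω : w → ℝ, ω i * ω i ∂Q = 1 := fun i => by
    have h := variance_of_integral_eq_zero (hlaw i).aemeasurable (hmean i)
    rw [(hlaw i).variance_eq, variance_id_gaussianReal] at h
    simpa [sq] using h.symm
  let e : w → Lp ℝ 2 Q := fun i => (hL i).toLp
  have he : ∀ i, e i =ᵐ[Q] fun ω => ω i := fun i => (hL i).coeFn_toLp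
  have hinner : ∀ i j, inner ℝ (e i) (e j) = ∫ ω : w → ℝ, ω i * ω j ∂Q := fun i j => by
    rw [L2.inner_def]
    refine integral_congr_ae ?_
    filter_upwards [he i, he j] with ω h1 h2
    simp [h1, h2, mul_comm]
  have hon : Orthonormal ℝ e := by
    rw [orthonormal_iff_ite]
    intro i j
    rw [hinner]
    split_ifs with hij
    · rw [← hij, hvar]
    · have := (hind.indepFun hij).integral_mul_eq_mul_integral (hL i).1 (hL j).1
      simpa [hmean] using this
  -- Sends the Hilbert basis of `H` to the independent standard Gaussian coordinates.
  let W : H →ₗᵢ[ℝ] Lp ℝ 2 Q :=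
    hon.orthogonalFamily.linearIsometry.comp b.repr.toLinearIsometry
  have hmem : ∀ h, W h ∈ (Submodule.span ℝ (Set.range e)).topologicalClosure := fun h => by
    refine mem_closure_of_tendsto (hon.orthogonalFamily.hasSum_linearIsometry (b.repr h))
      (Eventually.of_forall fun I => ?_)
    refine Submodule.sum_mem _ fun i _ => ?_
    rw [LinearIsometry.toSpanSingleton_apply]
    exact Submodule.smul_mem _ _ (Submodule.subset_span ⟨i, rfl⟩)
  have hp : IsProbabilityMeasure Q := inferInstance
  refine ⟨w, Q, hp, W, fun h => ⟨hG.hasGaussianLaw_of_mem_closure_span he (hmem h), ?_⟩⟩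
  let c : Lp ℝ 2 Q := indicatorConstLp 2 MeasurableSet.univ (measure_ne_top _ _) (1 : ℝ)
  have hc : ∀ Y : Lp ℝ 2 Q, inner ℝ c Y = ∫ ω, Y ω ∂Q := fun Y => by
    rw [L2.inner_indicatorConstLp_one, setIntegral_univ]
  -- The mean is a continuous functional that vanishes on the coordinates, hence on their closed
  -- span.
  have hker : (Submodule.span ℝ (Set.range e)).topologicalClosure ≤ (innerSL ℝ c).ker := by
    refine Submodule.topologicalClosure_minimal _ (Submodule.span_le.2 ?_)
      (innerSL ℝ c).isClosed_ker
    rintro _ ⟨i, rfl⟩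
    change inner ℝ c (e i) = 0
    rw [hc, integral_congr_ae (he i), hmean]
  rw [← hc]
  exact hker (hmem h)

/-- A strongly measurable family of elements of `L₂` has a jointly measurable version. -/
theorem exists_measurable_version {Z Ω : Type*} [MeasurableSpace Z] [MeasurableSpace Ω]
    {Q : Measure Ω} [IsProbabilityMeasure Q] {Φ : Z → Lp ℝ 2 Q} (hΦ : StronglyMeasurable Φ) :
    ∃ g : Z → Ω → ℝ, (Measurable fun p : Z × Ω => g p.1 p.2) ∧ ∀ z, g z =ᵐ[Q] Φ z := by
  classical
  rcases isEmpty_or_nonempty Z with hZ | ⟨⟨z₀⟩⟩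
  · exact ⟨fun _ _ => 0, measurable_const, fun z => hZ.elim z⟩
  obtain ⟨c, hc, hcl⟩ := hΦ.isSeparable_range
  have hne : c.Nonempty := closure_nonempty_iff.1 ⟨_, hcl ⟨z₀, rfl⟩⟩
  obtain ⟨d, rfl⟩ := hc.exists_eq_range hne
  -- Summable rates: for each `z` the `L₁` errors then have a finite sum, so the approximants
  -- converge almost surely and not only in `L₂`.
  let ε : ℕ → ℝ := fun k => (1 / 2) ^ k
  have hε : ∀ k, 0 < ε k := fun k => by positivity
  have hex : ∀ k z, ∃ n, ‖d n - Φ z‖ < ε k := fun k z => by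
    obtain ⟨_, ⟨n, rfl⟩, hn⟩ := Metric.mem_closure_iff.1 (hcl ⟨z, rfl⟩) (ε k) (hε k)
    exact ⟨n, by rwa [dist_comm, dist_eq_norm] at hn⟩
  -- The first member of the dense sequence within `ε k` of `Φ z`. As `N k` is measurable and
  -- countably valued, `d (N k z) ω` is jointly measurable.
  let N : ℕ → Z → ℕ := fun k z => Nat.find (hex k z)
  have hN : ∀ k z, ‖d (N k z) - Φ z‖ < ε k := fun k z => Nat.find_spec (hex k z)
  have hNm : ∀ k, Measurable (N k) := fun k => by
    refine measurable_find (hex k) fun n => ?_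
    exact measurableSet_lt (stronglyMeasurable_const.sub hΦ).norm.measurable measurable_const
  have hGm : ∀ k, Measurable fun p : Z × Ω => d (N k p.1) p.2 := fun k => by
    have : Measurable fun q : ℕ × Ω => d q.1 q.2 :=
      measurable_from_prod_countable_right fun n => (Lp.stronglyMeasurable (d n)).measurable
    exact this.comp (((hNm k).comp measurable_fst).prodMk measurable_snd)
  refine ⟨fun z ω => limUnder atTop fun k => d (N k z) ω,
    (StronglyMeasurable.limUnder fun k => (hGm k).stronglyMeasurable).measurable, fun z => ?_⟩
  have hsum : ∫⁻ ω, ∑' k, ‖(d (N k z) - Φ z) ω‖ₑ ∂Q ≠ ⊤ := by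
    rw [lintegral_tsum fun k => (Lp.stronglyMeasurable _).measurable.enorm.aemeasurable]
    refine ne_top_of_le_ne_top (b := ∑' k, ENNReal.ofReal (ε k)) ?_ (ENNReal.tsum_le_tsum fun k => ?_)
    · rw [← ENNReal.ofReal_tsum_of_nonneg (fun k => (hε k).le) summable_geometric_two]
      exact ENNReal.ofReal_ne_top
    · rw [← eLpNorm_one_eq_lintegral_enorm]
      refine (eLpNorm_le_eLpNorm_of_exponent_le one_le_two (Lp.aestronglyMeasurable _)).trans ?_
      rw [← ENNReal.ofReal_toReal (Lp.eLpNorm_ne_top (d (N k z) - Φ z)), ← Lp.norm_def]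
      exact ENNReal.ofReal_le_ofReal (hN k z).le
  have hfin := ae_lt_top' (AEMeasurable.tsum fun k =>
    (Lp.stronglyMeasurable (d (N k z) - Φ z)).measurable.enorm.aemeasurable) hsum
  have hsub : ∀ᵐ ω ∂Q, ∀ k, (d (N k z) - Φ z) ω = d (N k z) ω - Φ z ω :=
    ae_all_iff.2 fun k => Lp.coeFn_sub _ _
  filter_upwards [hfin, hsub] with ω h1 h2
  refine Tendsto.limUnder_eq ?_
  have h3 := ENNReal.tendsto_atTop_zero_of_tsum_ne_top h1.ne
  simp_rw [h2] at h3
  rw [tendsto_iff_edist_tendsto_0]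
  simpa only [edist_eq_enorm_sub] using h3

/-- A centered Gaussian process with a jointly measurable version exists for each kernel with a
strongly measurable feature map. -/
theorem exists_isCenteredGP {Z : Type*} [MeasurableSpace Z] {H : Type*} [NormedAddCommGroup H]
    [InnerProductSpace ℝ H] [CompleteSpace H] {ψ : Z → H} (hψ : StronglyMeasurable ψ) :
    ∃ (w : Set H) (Q : Measure (w → ℝ)) (g : Z → (w → ℝ) → ℝ),
      IsProbabilityMeasure Q ∧ IsCenteredGP (fun s t => inner ℝ (ψ s) (ψ t)) g Q := by
  obtain ⟨w, Q, hQ, W, hW⟩ := exists_isonormal H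
  obtain ⟨g, hg, hgW⟩ := exists_measurable_version
    (W.continuous.comp_stronglyMeasurable hψ)
  refine ⟨w, Q, g, hQ, hg, ?_, fun t => ?_, fun s t => ?_⟩
  · exact ((isGaussianProcess_of_linear W.toLinearMap fun h => (hW h).1).comp_right ψ).congr
      fun t => (hgW t).symm
  · rw [integral_congr_ae (hgW t)]
    exact (hW _).2
  · have hL : ∀ t, MemLp (g t) 2 Q := fun t => (memLp_congr_ae (hgW t)).2 (Lp.memLp _)
    rw [covariance_eq_sub (hL s) (hL t), integral_congr_ae (hgW s), integral_congr_ae (hgW t)]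
    simp only [(hW _).2, mul_zero, sub_zero]
    rw [← W.inner_map_map, L2.inner_def]
    refine integral_congr_ae ?_
    filter_upwards [hgW s, hgW t] with ω h1 h2
    simp [h1, h2, mul_comm]

end ProbabilityTheory

/-! ### Feature maps, their operators and conditional expectation -/

section Feature

variable {T : Type*} [MeasurableSpace T] {μ : Measure T} {H : Type*} [NormedAddCommGroup H]
  [InnerProductSpace ℝ H]

omit [MeasurableSpace T] in
theorem isKernel_inner (ψ : T → H) : IsKernel fun s t => inner ℝ (ψ s) (ψ t) := by
  refine ⟨Matrix.IsHermitian.ext fun i j => real_inner_comm _ _, fun x => ?_⟩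
  have : (x.sum fun i xi => x.sum fun j xj => star xi * (inner ℝ (ψ i) (ψ j) : ℝ) * xj)
      = inner ℝ (x.sum fun i xi => xi • ψ i) (x.sum fun i xi => xi • ψ i) := by
    simp only [Finsupp.sum, sum_inner, inner_sum, inner_smul_left, inner_smul_right,
      Finset.mul_sum]
    rw [Finset.sum_comm]
    refine Finset.sum_congr rfl fun i _ => Finset.sum_congr rfl fun j _ => ?_
    simp only [star_trivial, conj_trivial]
    ring
  exact this ▸ real_inner_self_nonneg

/-- The operator `h ↦ ⟨h, ψ(·)⟩` from the feature space into `L₂`. -/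
def featureOperator {ψ : T → H} (hψ : MemLp ψ 2 μ) : H →L[ℝ] Lp ℝ 2 μ :=
  LinearMap.mkContinuous
    { toFun h := (innerSL ℝ h).compLp (hψ.toLp ψ)
      map_add' h h' := by rw [map_add, ContinuousLinearMap.add_compLp]
      map_smul' c h := by
        rw [map_smul, ContinuousLinearMap.smul_compLp]
        rfl }
    ‖hψ.toLp ψ‖ fun h => by
      rw [mul_comm, ← innerSL_apply_norm (𝕜 := ℝ) h]
      exact ContinuousLinearMap.norm_compLp_le _ _

theorem coeFn_featureOperator {ψ : T → H} (hψ : MemLp ψ 2 μ) (h : H) :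
    featureOperator hψ h =ᵐ[μ] fun t => inner ℝ h (ψ t) := by
  filter_upwards [(innerSL ℝ h).coeFn_compLp (hψ.toLp ψ), hψ.coeFn_toLp] with t h1 h2
  rw [← h2, ← innerSL_apply_apply ℝ h, ← h1]
  rfl

theorem integrable_smul_feature {ψ : T → H} (hψ : MemLp ψ 2 μ) (u : Lp ℝ 2 μ) :
    Integrable (fun t => u t • ψ t) μ :=
  memLp_one_iff_integrable.1 (hψ.smul (Lp.memLp u))

variable [CompleteSpace H]

theorem adjoint_featureOperator_apply {ψ : T → H} (hψ : MemLp ψ 2 μ) (u : Lp ℝ 2 μ) :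
    ContinuousLinearMap.adjoint (featureOperator hψ) u = ∫ t, u t • ψ t ∂μ := by
  refine ext_inner_left ℝ fun h => ?_
  rw [ContinuousLinearMap.adjoint_inner_right, ← integral_inner (integrable_smul_feature hψ u),
    L2.inner_def]
  refine integral_congr_ae ?_
  filter_upwards [coeFn_featureOperator hψ h] with t ht
  simp [ht, inner_smul_right]

/-- The adjoint is `u ↦ ∫ u ψ`, and pairing this Bochner integral with `ψ s` moves the inner product
under the integral. -/
theorem isIntegralOperator_featureOperator {ψ : T → H} (hψ : MemLp ψ 2 μ) :
    IsIntegralOperator (fun s t => inner ℝ (ψ s) (ψ t)) μ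
      (featureOperator hψ ∘L ContinuousLinearMap.adjoint (featureOperator hψ)) := by
  intro u
  have hu := integrable_smul_feature hψ u
  have h1 : ∀ s t, inner ℝ (ψ t) (ψ s) * u t = inner ℝ (ψ s) (u t • ψ t) := fun s t => by
    rw [inner_smul_right, real_inner_comm, mul_comm]
  simp only [h1]
  refine ⟨ae_of_all _ fun s => hu.const_inner _, ?_⟩
  filter_upwards [coeFn_featureOperator hψ (ContinuousLinearMap.adjoint (featureOperator hψ) u)]
    with s hs
  rw [ContinuousLinearMap.comp_apply, hs, integral_inner hu, adjoint_featureOperator_apply,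
    real_inner_comm]

end Feature

universe u in
/-- The feature map of a kernel. -/
theorem IsKernel.exists_feature {T : Type u} {k : T → T → ℝ} (hk : IsKernel k) :
    ∃ (H : Type u) (_ : NormedAddCommGroup H) (_ : InnerProductSpace ℝ H) (_ : CompleteSpace H)
      (φ : T → H), ∀ s t, inner ℝ (φ s) (φ t) = k s t := by
  -- The scalar kernel seen as an operator-valued one, acting on `ℝ` by multiplication; the features
  -- are then its kernel functions applied to `1`.
  let K : Matrix T T (ℝ →L[ℝ] ℝ) := Matrix.of fun s t => k s t • ContinuousLinearMap.id ℝ ℝ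
  have hsymm : ∀ s t, k s t = k t s := fun s t => hk.1.apply t s
  have hK : K.PosSemidef := by
    have h := (RKHS.posSemidef_tfae (K := K)).out 0 2
    refine h.2 ⟨?_, fun v => ?_⟩
    · refine Matrix.IsHermitian.ext fun s t => ?_
      have h1 : star (ContinuousLinearMap.id ℝ ℝ) = ContinuousLinearMap.id ℝ ℝ := star_one _
      ext
      simp [K, hsymm s t, h1]
    · refine (hk.2 v).trans_eq ?_
      simp only [K, Finsupp.sum, RCLike.re_to_real]
      refine Finset.sum_congr rfl fun i _ => Finset.sum_congr rfl fun j _ => ?_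
      simp [hsymm i j]
      ring
  have : Fact K.PosSemidef := ⟨hK⟩
  refine ⟨RKHS.OfKernel K, inferInstance, inferInstance, inferInstance,
    fun s => RKHS.kerFun (RKHS.OfKernel K) s 1, fun s t => ?_⟩
  rw [← RKHS.kernel_inner, RKHS.OfKernel.kernel_ofKernel]
  simp [K, hsymm s t]

/-- `‖φ s - φ t‖² = k s s - 2 k s t + k t t`, which tends to `0` as `s → t`. -/
theorem continuous_of_continuous_inner {T H : Type*} [TopologicalSpace T] [NormedAddCommGroup H]
    [InnerProductSpace ℝ H] {φ : T → H}
    (h : Continuous fun p : T × T => (inner ℝ (φ p.1) (φ p.2) : ℝ)) : Continuous φ := by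
  refine continuous_iff_continuousAt.2 fun t => tendsto_iff_norm_sub_tendsto_zero.2 ?_
  have h1 : Continuous fun s => √(inner ℝ (φ s) (φ s) - 2 * inner ℝ (φ s) (φ t) + inner ℝ (φ t) (φ t)) := by
    have h2 : Continuous fun s => (inner ℝ (φ s) (φ s) : ℝ) := h.comp (continuous_id.prodMk continuous_id)
    have h3 : Continuous fun s => (inner ℝ (φ s) (φ t) : ℝ) :=
      h.comp (continuous_id.prodMk continuous_const)
    fun_prop
  have h4 := h1.tendsto t
  refine (h4.congr fun s => ?_).trans_eq ?_
  · rw [real_inner_self_eq_norm_sq, real_inner_self_eq_norm_sq, ← norm_sub_sq_real,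
      Real.sqrt_sq (norm_nonneg _)]
  · congr 1
    ring_nf
    simp

/-- The conditional expectation operator maps `⟨h, φ(·)⟩` to `⟨h, ψ(·)⟩` if
`ψ(z) = 𝔼[φ(x) | z]`. -/
theorem condExpOperator_comp_featureOperator {Ω X Z H : Type*} [MeasurableSpace Ω]
    [MeasurableSpace X] [mZ : MeasurableSpace Z] [NormedAddCommGroup H] [InnerProductSpace ℝ H]
    [CompleteSpace H] (P : Measure Ω) [IsProbabilityMeasure P] {x : Ω → X} {z : Ω → Z}
    (hx : Measurable x) (hz : Measurable z) {φ : X → H} {ψ : Z → H} (hφ : MemLp φ 2 (P.map x))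
    (hψ : MemLp ψ 2 (P.map z)) (h : ψ ∘ z =ᵐ[P] P[φ ∘ x | mZ.comap z]) :
    condExpOperator P hx hz ∘L featureOperator hφ = featureOperator hψ := by
  have : IsProbabilityMeasure (P.map x) := Measure.isProbabilityMeasure_map hx.aemeasurable
  ext1 v
  refine Lp.ext ?_
  have hint : Integrable (φ ∘ x) P := (hφ.integrable one_le_two).comp_measurable hx
  have h1 : ∀ᵐ ω ∂P, condExpOperator P hx hz (featureOperator hφ v) (z ω)
      = featureOperator hψ v (z ω) := by
    have h2 := condExpOperator_ae_eq P hx hz (featureOperator hφ v)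
    have h3 : (fun ω => featureOperator hφ v (x ω)) =ᵐ[P] innerSL ℝ v ∘ φ ∘ x :=
      ae_of_ae_map hx.aemeasurable (coeFn_featureOperator hφ v)
    have h4 := ae_of_ae_map hz.aemeasurable (coeFn_featureOperator hψ v)
    filter_upwards [h2, condExp_congr_ae (m := mZ.comap z) h3,
      (innerSL ℝ v).comp_condExp_comm (m := mZ.comap z) hint, h4, h] with ω e2 e3 e5 e4 e6
    rw [e2, e3, ← e5, e4]
    simp only [Function.comp_apply] at e6 ⊢
    rw [← e6, innerSL_apply_apply]
  exact (ae_map_iff hz.aemeasurable (measurableSet_eq_fun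
    (Lp.stronglyMeasurable _).measurable (Lp.stronglyMeasurable _).measurable)).2 h1

end

/-! ### The main theorem -/

theorem mainTheorem6 {d : ℕ} (X : Set (EuclideanSpace ℝ (Fin d))) (_hX : Bornology.IsBounded X)
    {Z : Type*} [MeasurableSpace Z]
    {Ω : Type*} [MeasurableSpace Ω] (P : Measure Ω) [IsProbabilityMeasure P]
    (x : Ω → X) (z : Ω → Z) (hx : Measurable x) (hz : Measurable z)
    (kx : X → X → ℝ) (_hkx : IsKernel kx)
    (_hkx_bdd : ∃ C : ℝ, ∀ s t, |kx s t| ≤ C)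
    (_hkx_cont : Continuous fun p : X × X => kx p.1 p.2) :
    ∃ kz : Z → Z → ℝ,
      -- `kz` is a measurable kernel with integrable diagonal
      IsKernel kz ∧ (Measurable fun p : Z × Z => kz p.1 p.2) ∧
      Integrable (fun s => kz s s) (P.map z) ∧
      -- its integral operator is `E Tx Eᵀ`, where `Tx` is the integral operator of `kx`
      (∃ Tx : Lp ℝ 2 (P.map x) →L[ℝ] Lp ℝ 2 (P.map x),
        IsIntegralOperator kx (P.map x) Tx ∧
        IsIntegralOperator kz (P.map z)
          (condExpOperator P hx hz ∘L Tx ∘L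
            ContinuousLinearMap.adjoint (condExpOperator P hx hz))) ∧
      -- `GP(0, kz)` has a realization
      (∃ (Ω₀ : Type) (_ : MeasurableSpace Ω₀) (Q₀ : Measure Ω₀) (g : Z → Ω₀ → ℝ),
        IsProbabilityMeasure Q₀ ∧ IsCenteredGP kz g Q₀) ∧
      -- for `f ∼ GP(0, kx)` and `g ∼ GP(0, kz)`, `E [f]∼` and `[g]∼` have the same law
      ∀ (Ω₁ : Type*) [MeasurableSpace Ω₁] (Q₁ : Measure Ω₁) [IsProbabilityMeasure Q₁]
        (f : X → Ω₁ → ℝ), IsCenteredGP kx f Q₁ →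
      ∀ (Ω₂ : Type*) [MeasurableSpace Ω₂] (Q₂ : Measure Ω₂) [IsProbabilityMeasure Q₂]
        (g : Z → Ω₂ → ℝ), IsCenteredGP kz g Q₂ →
        (∀ᵐ ω ∂Q₁, MemLp (fun s => f s ω) 2 (P.map x)) ∧
        (∀ᵐ ω ∂Q₂, MemLp (fun s => g s ω) 2 (P.map z)) ∧
        IdentDistrib
          (fun ω => condExpOperator P hx hz (l2Class (P.map x) fun s => f s ω))
          (fun ω => l2Class (P.map z) fun s => g s ω) Q₁ Q₂ := by
  have hPx : IsProbabilityMeasure (P.map x) := Measure.isProbabilityMeasure_map hx.aemeasurable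
  have hPz : IsProbabilityMeasure (P.map z) := Measure.isProbabilityMeasure_map hz.aemeasurable
  obtain ⟨C, hC⟩ := _hkx_bdd
  obtain ⟨H, _, _, _, φ, hφ⟩ := _hkx.exists_feature
  obtain rfl : (fun s t => inner ℝ (φ s) (φ t)) = kx := funext₂ hφ
  have hφc : Continuous φ := continuous_of_continuous_inner _hkx_cont
  have hφb : ∀ s, ‖φ s‖ ≤ √C := fun s => by
    rw [← Real.sqrt_sq (norm_nonneg (φ s)), ← real_inner_self_eq_norm_sq]
    exact Real.sqrt_le_sqrt ((le_abs_self _).trans (hC s s))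
  have hφL : MemLp φ 2 (P.map x) :=
    MemLp.of_bound hφc.stronglyMeasurable.aestronglyMeasurable _ (ae_of_all _ hφb)
  -- Doob–Dynkin: a function strongly measurable for `σ(z)` factors through `z`, here everywhere and
  -- with strongly measurable `ψ`.
  obtain ⟨ψ, hψm, hψ⟩ := (stronglyMeasurable_condExp (f := φ ∘ x) (μ := P)
    (m := MeasurableSpace.comap z inferInstance)).exists_eq_measurable_comp
  have hψb : ∀ᵐ s ∂P.map z, ‖ψ s‖ ≤ √C := by
    refine (ae_map_iff hz.aemeasurable (measurableSet_le hψm.norm.measurable measurable_const)).2 ?_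
    have := ae_bdd_norm_condExp_of_ae_bdd_norm (m := MeasurableSpace.comap z inferInstance)
      (f := φ ∘ x) (μ := P) (R := √C) (ae_of_all _ fun ω => hφb (x ω))
    rw [hψ] at this
    exact this
  have hψL : MemLp ψ 2 (P.map z) := MemLp.of_bound hψm.aestronglyMeasurable _ hψb
  have hE := condExpOperator_comp_featureOperator P hx hz hφL hψL (hψ ▸ ae_eq_rfl)
  have hTz : condExpOperator P hx hz ∘L (featureOperator hφL ∘L
      ContinuousLinearMap.adjoint (featureOperator hφL)) ∘L
        ContinuousLinearMap.adjoint (condExpOperator P hx hz)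
      = featureOperator hψL ∘L ContinuousLinearMap.adjoint (featureOperator hψL) := by
    rw [← hE, ContinuousLinearMap.adjoint_comp]
    rfl
  have hix : Integrable (fun s => (inner ℝ (φ s) (φ s) : ℝ)) (P.map x) := by
    simpa only [real_inner_self_eq_norm_sq] using hφL.norm.integrable_sq
  have hiz : Integrable (fun s => (inner ℝ (ψ s) (ψ s) : ℝ)) (P.map z) := by
    simpa only [real_inner_self_eq_norm_sq] using hψL.norm.integrable_sq
  refine ⟨fun s t => inner ℝ (ψ s) (ψ t), isKernel_inner ψ,
    ((hψm.comp_measurable measurable_fst).inner (hψm.comp_measurable measurable_snd)).measurable,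
    hiz, ⟨_, isIntegralOperator_featureOperator hφL, hTz ▸ isIntegralOperator_featureOperator hψL⟩,
    ?_, ?_⟩
  · obtain ⟨w, Q, g, hQ, hg⟩ := exists_isCenteredGP hψm
    -- The sample space fits in `Type` because the feature space `H` lives in the universe of `X`,
    -- and `w` is a subset of `H`.
    exact ⟨w → ℝ, _, Q, g, hQ, hg⟩
  · intro Ω₁ _ Q₁ _ f hf Ω₂ _ Q₂ _ g hg
    refine ⟨hf.ae_memLp hix, hg.ae_memLp hiz, identDistrib_of_inner
      ((condExpOperator P hx hz).continuous.comp_aestronglyMeasurable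
        (hf.aestronglyMeasurable_l2Class hix)) (hg.aestronglyMeasurable_l2Class hiz) fun u => ?_⟩
    rw [hg.map_inner_l2Class hiz (isIntegralOperator_featureOperator hψL), ← hTz]
    -- Turns `⟪u, E[f]⟫` into `⟪Eᵀu, [f]⟫`, a projection of the path of `f` itself.
    simp_rw [← ContinuousLinearMap.adjoint_inner_left (condExpOperator P hx hz)]
    rw [hf.map_inner_l2Class hix (isIntegralOperator_featureOperator hφL)]
    simp only [ContinuousLinearMap.comp_apply, ContinuousLinearMap.adjoint_inner_left]
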